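/- For complex $a$ and $|q|<1$ let $(a;q)_n=\prod_{m=0}^{n-1}(1-aq^m)$ and $(a;q)_\infty=\prod_{m=0}^{\infty}(1-aq^m)$. Define $$\omega_1(\alpha,z;q)=\sum_{n=0}^{\infty}\frac{q^{2n}}{(-zq;q^2)_{n+1}(zq/\alpha;q^2)_{n+1}},\qquad \omega(z;q)=\sum_{n=0}^{\infty}\frac{z^nq^{2n^2+2n}}{(q;q^2)_{n+1}(zq;q^2)_{n+1}},$$ $$F(\alpha,z;q)=\frac{1}{(-zq^2/\alpha;q^2)_\infty(zq^2;q^2)_\infty}\Bigg(\frac{q^2}{1+zq/\alpha}\sum_{m=0}^{\infty}\frac{(-\alpha/(zq);q^2)_{m+1}}{(-zq;q^2)_{m+1}}(zq)^m-\frac{\alpha q}{z}\,\frac{(z^2q^2/\alpha;q^2)_\infty}{(z^2q^2;q^4)_\infty(z^2q^2/\alpha^2;q^4)_\infty}\sum_{n=0}^{\infty}\alpha^nq^{n^2+n}\Bigg).$$ **Theorem.** Let $q,z\in\mathbb C$ with $0<|q|<1$ and $0<|zq|<1$. (i) Let $\alpha\in\mathbb C\setminus\{0\}$ be such that $\alpha\neq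 -zq^{n+1}$ and $\alpha\neq zq^{2n+1}$ for all integers $n\ge 0$ (so that no denominator below vanishes). Then the series defining $\omega_1(\alpha,z;q)$, both series in $F(\alpha,z;q)$ and the series below converge absolutely, and $$\sum_{m=1}^{\infty}\frac{(z^2q^2/\alpha;q^2)_{m-1}\,q^{2m}}{(-zq/\alpha;q)_{2m}(zq;q)_{2m}(-zq^{2m+2}/\alpha;q^2)_\infty(zq^{2m+2};q^2)_\infty}=\frac{q^2(z^2q^2/\alpha;q^2)_\infty}{(zq;q)_\infty(-zq/\alpha;q)_\infty}\,\omega_1(\alpha,z;q)+F(\alpha,z;q).$$ (ii) $F(1,z;q)=0$. (iii) The Andrews–Yee identity holds, with both series absolutely convergent: $$\sum_{m=1}^{\infty}\frac{q^m}{(zq^m;q)_{m+1}(zq^{2m+2};q^2)_\infty}=q\,\omega(z;q).$$ -/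

import Mathlib

/-- The finite `q`-Pochhammer symbol `(a;q)_n = ∏_{m=0}^{n-1} (1 - a q^m)`. -/
noncomputable def qPoch (a q : ℂ) (n : ℕ) : ℂ :=
  ∏ m ∈ Finset.range n, (1 - a * q ^ m)

/-- The infinite `q`-Pochhammer symbol `(a;q)_∞ = ∏_{m=0}^∞ (1 - a q^m)`, used for `|q| < 1`. -/
noncomputable def qPochInf (a q : ℂ) : ℂ :=
  ∏' m : ℕ, (1 - a * q ^ m)

/-- For `|q| < 1` the infinite product defining `(a;q)_∞` converges. -/
theorem multipliable_qPochInf (a : ℂ) {q : ℂ} (hq : ‖q‖ < 1) :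
    Multipliable fun m : ℕ => 1 - a * q ^ m := by
  have h : Summable fun m : ℕ => ‖-(a * q ^ m)‖ := by
    simp only [norm_neg, norm_mul, norm_pow]
    exact (summable_geometric_of_lt_one (norm_nonneg q) hq).mul_left _
  simpa [sub_eq_add_neg] using multipliable_one_add_of_summable h

/-- For `|q| < 1`, `(a;q)_∞` is the limit of `(a;q)_n`. -/
theorem tendsto_qPoch (a : ℂ) {q : ℂ} (hq : ‖q‖ < 1) :
    Filter.Tendsto (qPoch a q) Filter.atTop (nhds (qPochInf a q)) :=
  (multipliable_qPochInf a hq).hasProd.tendsto_prod_nat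

/-- The `n`-th term of the series `ω₁(α,z;q)`. -/
noncomputable def omegaOneTerm (α z q : ℂ) (n : ℕ) : ℂ :=
  q ^ (2 * n) / (qPoch (-(z * q)) (q ^ 2) (n + 1) * qPoch (z * q / α) (q ^ 2) (n + 1))

/-- The trivariate mock theta function
`ω₁(α,z;q) = ∑_{n≥0} q^{2n} / ((-zq;q²)_{n+1} (zq/α;q²)_{n+1})`. -/
noncomputable def omegaOne (α z q : ℂ) : ℂ :=
  ∑' n : ℕ, omegaOneTerm α z q n

/-- The `n`-th term of the series `ω(z;q)`. -/
noncomputable def omegaTwoVarTerm (z q : ℂ) (n : ℕ) : ℂ :=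
  z ^ n * q ^ (2 * n ^ 2 + 2 * n) / (qPoch q (q ^ 2) (n + 1) * qPoch (z * q) (q ^ 2) (n + 1))

/-- Andrews' two-variable mock theta function
`ω(z;q) = ∑_{n≥0} zⁿ q^{2n²+2n} / ((q;q²)_{n+1} (zq;q²)_{n+1})`. -/
noncomputable def omegaTwoVar (z q : ℂ) : ℂ :=
  ∑' n : ℕ, omegaTwoVarTerm z q n

/-- The `m`-th term of the first series in the correction term `F(α,z;q)`. -/
noncomputable def corrTerm (α z q : ℂ) (m : ℕ) : ℂ :=
  qPoch (-(α / (z * q))) (q ^ 2) (m + 1) / qPoch (-(z * q)) (q ^ 2) (m + 1) * (z * q) ^ m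

/-- The `n`-th term `αⁿ q^{n²+n}` of the partial theta series. -/
noncomputable def partialThetaTerm (α q : ℂ) (n : ℕ) : ℂ :=
  α ^ n * q ^ (n ^ 2 + n)

/-- The correction term `F(α,z;q)`. -/
noncomputable def corrF (α z q : ℂ) : ℂ :=
  1 / (qPochInf (-(z * q ^ 2 / α)) (q ^ 2) * qPochInf (z * q ^ 2) (q ^ 2)) *
    (q ^ 2 / (1 + z * q / α) * ∑' m : ℕ, corrTerm α z q m -
      α * q / z *
        (qPochInf (z ^ 2 * q ^ 2 / α) (q ^ 2) /
          (qPochInf (z ^ 2 * q ^ 2) (q ^ 4) * qPochInf (z ^ 2 * q ^ 2 / α ^ 2) (q ^ 4))) *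
        ∑' n : ℕ, partialThetaTerm α q n)

/-- The summand, at the smallest part `m ≥ 1`, of the left-hand side of the trivariate identity. -/
noncomputable def smallestPartTerm (α z q : ℂ) (m : ℕ) : ℂ :=
  qPoch (z ^ 2 * q ^ 2 / α) (q ^ 2) (m - 1) * q ^ (2 * m) /
    (qPoch (-(z * q / α)) q (2 * m) * qPoch (z * q) q (2 * m) *
      qPochInf (-(z * q ^ (2 * m + 2) / α)) (q ^ 2) * qPochInf (z * q ^ (2 * m + 2)) (q ^ 2))

/-- The summand, at the smallest part `m ≥ 1`, of the left-hand side of the Andrews–Yee identity. -/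
noncomputable def andrewsYeeTerm (z q : ℂ) (m : ℕ) : ℂ :=
  q ^ m / (qPoch (z * q ^ m) q (m + 1) * qPochInf (z * q ^ (2 * m + 2)) (q ^ 2))

/-! Put `x = zq`, `u = zq/α` and replace `q²` by `q`. Up to elementary factors the trivariate
identity then relates four series in `x`: `partsTerm` (the left side), `mockTerm` (`ω₁`), and
`fineTerm` and `thetaTerm` (the two series in `F`). With `u` fixed, each sum satisfies a first-order
q-difference equation linking `x` to `xq`, found by telescoping. In the difference of the two sides,
`partsDefect`, all inhomogeneous terms cancel, leaving `D(x) = c(x) D(xq)`. Since `D(xq^k)` is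
bounded in `k` and `c(xq^k) → 0`, iteration forces `D = 0` (`partsDefect_eq_zero`).

At `α = 1` one has `u = x`. The `fineTerm` sum then satisfies a homogeneous equation with an
explicit product solution `g`; the quotient by `g` is constant along `xq^k`, and its limit is the
theta constant (`tsum_diagTerm`). So the two series in `F` cancel.

For Andrews–Yee, use the diagonal identity `u = x` again, now in base `q` itself with `x² = zq`.
Products `(x;q)(-x;q)` collapse to `(zq;q²)`, the mock side becomes `∑ qⁿ/(zq;q²)_{n+1}`, and a
Rogers–Fine transformation (`tsum_geomTerm`) turns this into `ω(z;q)`. -/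

/-! ### Pochhammer algebra and bounds uniform under shifts. -/

theorem qPoch_zero (a q : ℂ) : qPoch a q 0 = 1 := by simp [qPoch]

theorem qPoch_succ (a q : ℂ) (n : ℕ) : qPoch a q (n + 1) = qPoch a q n * (1 - a * q ^ n) := by
  simp [qPoch, Finset.prod_range_succ]

theorem qPoch_add (a q : ℂ) (m n : ℕ) :
    qPoch a q (m + n) = qPoch a q m * qPoch (a * q ^ m) q n := by
  simp only [qPoch, Finset.prod_range_add, pow_add, mul_assoc]

theorem qPoch_one (a q : ℂ) : qPoch a q 1 = 1 - a := by simp [qPoch]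

theorem qPoch_succ' (a q : ℂ) (n : ℕ) : qPoch a q (n + 1) = (1 - a) * qPoch (a * q) q n := by
  rw [add_comm, qPoch_add, qPoch_one, pow_one]

theorem qPoch_two_mul (a q : ℂ) (n : ℕ) :
    qPoch a q (2 * n) = qPoch a (q ^ 2) n * qPoch (a * q) (q ^ 2) n := by
  induction n with
  | zero => simp [qPoch]
  | succ n ih =>
    rw [show 2 * (n + 1) = 2 * n + 1 + 1 by ring, qPoch_succ, qPoch_succ, ih, qPoch_succ, qPoch_succ]
    ring

theorem qPoch_mul_qPoch_neg (a q : ℂ) (n : ℕ) :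
    qPoch a q n * qPoch (-a) q n = qPoch (a ^ 2) (q ^ 2) n := by
  simp only [qPoch, ← Finset.prod_mul_distrib]
  exact Finset.prod_congr rfl fun _ _ => by ring

theorem qPoch_ne_zero {a q : ℂ} (h : ∀ n : ℕ, 1 - a * q ^ n ≠ 0) (n : ℕ) : qPoch a q n ≠ 0 :=
  Finset.prod_ne_zero_iff.2 fun m _ => h m

theorem qPochInf_eq_mul (a : ℂ) {q : ℂ} (hq : ‖q‖ < 1) (n : ℕ) :
    qPochInf a q = qPoch a q n * qPochInf (a * q ^ n) q := by
  refine tendsto_nhds_unique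
    ((tendsto_qPoch a hq).comp (Filter.tendsto_add_atTop_nat n)) ?_
  simpa [Function.comp_def, add_comm _ n, qPoch_add] using
    (tendsto_qPoch (a * q ^ n) hq).const_mul (qPoch a q n)

theorem qPochInf_succ (a : ℂ) {q : ℂ} (hq : ‖q‖ < 1) :
    qPochInf a q = (1 - a) * qPochInf (a * q) q := by
  simpa [qPoch_one] using qPochInf_eq_mul a hq 1

theorem norm_sq_lt_one {q : ℂ} (hq : ‖q‖ < 1) : ‖q ^ 2‖ < 1 := by
  rw [norm_pow]
  exact pow_lt_one₀ (norm_nonneg q) hq two_ne_zero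

theorem qPochInf_eq_even_mul_odd (a : ℂ) {q : ℂ} (hq : ‖q‖ < 1) :
    qPochInf a q = qPochInf a (q ^ 2) * qPochInf (a * q) (q ^ 2) := by
  have hq2 := norm_sq_lt_one hq
  refine tendsto_nhds_unique ((tendsto_qPoch a hq).comp
    (Filter.tendsto_id.const_mul_atTop' (two_pos (α := ℕ)))) ?_
  simpa [Function.comp_def, qPoch_two_mul] using
    (tendsto_qPoch a hq2).mul (tendsto_qPoch (a * q) hq2)

theorem qPochInf_mul_qPochInf_neg (a : ℂ) {q : ℂ} (hq : ‖q‖ < 1) :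
    qPochInf a q * qPochInf (-a) q = qPochInf (a ^ 2) (q ^ 2) := by
  refine tendsto_nhds_unique ((tendsto_qPoch a hq).mul (tendsto_qPoch (-a) hq)) ?_
  simpa [qPoch_mul_qPoch_neg] using tendsto_qPoch (a ^ 2) (norm_sq_lt_one hq)

theorem one_sub_mul_pow_ne_zero {a q : ℂ} (ha : ‖a‖ < 1) (hq : ‖q‖ < 1) (n : ℕ) :
    1 - a * q ^ n ≠ 0 := by
  intro h
  have h1 : ‖a * q ^ n‖ < 1 := by
    rw [norm_mul, norm_pow]
    exact (mul_le_of_le_one_right (norm_nonneg a) (pow_le_one₀ (norm_nonneg q) hq.le)).trans_lt ha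
  rw [← sub_eq_zero.1 h, norm_one] at h1
  exact lt_irrefl _ h1

theorem qPochInf_ne_zero {a q : ℂ} (hq : ‖q‖ < 1) (h : ∀ n : ℕ, 1 - a * q ^ n ≠ 0) :
    qPochInf a q ≠ 0 := by
  have hs : Summable fun m : ℕ => ‖-(a * q ^ m)‖ := by
    simp only [norm_neg, norm_mul, norm_pow]
    exact (summable_geometric_of_lt_one (norm_nonneg q) hq).mul_left _
  have := tprod_one_add_ne_zero_of_summable (f := fun m : ℕ => -(a * q ^ m))
    (fun m => by simpa [sub_eq_add_neg] using h m) hs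
  simpa [qPochInf, sub_eq_add_neg] using this

/-- Since `|1 - w| ≤ exp |w|`, the product is at most the exponential of a geometric series.
Uniformity in `k` is what the iteration `x ↦ xq` requires later. -/
theorem exists_norm_qPoch_le (a : ℂ) {q : ℂ} (hq : ‖q‖ < 1) :
    ∃ M, 0 ≤ M ∧ ∀ k n : ℕ, ‖qPoch (a * q ^ k) q n‖ ≤ M := by
  have hs : Summable fun m : ℕ => ‖a‖ * ‖q‖ ^ m :=
    (summable_geometric_of_lt_one (norm_nonneg q) hq).mul_left _
  refine ⟨Real.exp (∑' m : ℕ, ‖a‖ * ‖q‖ ^ m), (Real.exp_pos _).le, fun k n => ?_⟩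
  have h1 : ∀ m : ℕ, ‖1 - a * q ^ k * q ^ m‖ ≤ Real.exp (‖a‖ * ‖q‖ ^ m) := fun m => by
    have h2 : ‖a * q ^ k * q ^ m‖ ≤ ‖a‖ * ‖q‖ ^ m := by
      rw [norm_mul, norm_mul, norm_pow, norm_pow]
      exact mul_le_mul_of_nonneg_right (mul_le_of_le_one_right (norm_nonneg a)
        (pow_le_one₀ (norm_nonneg q) hq.le)) (by positivity)
    have h3 := norm_sub_le (1 : ℂ) (a * q ^ k * q ^ m)
    rw [norm_one] at h3
    linarith [Real.add_one_le_exp (‖a‖ * ‖q‖ ^ m)]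
  rw [qPoch, norm_prod]
  refine (Finset.prod_le_prod (fun _ _ => norm_nonneg _) fun m _ => h1 m).trans ?_
  rw [← Real.exp_sum]
  exact Real.exp_le_exp.2 (hs.sum_le_tsum _ fun _ _ => by positivity)

/-- Write `1/(aq^k;q)_n = (a;q)_k / (a;q)_{k+n}`; the reciprocals `1/(a;q)_n` converge, hence are
bounded. -/
theorem exists_norm_inv_qPoch_le {a q : ℂ} (hq : ‖q‖ < 1) (h : ∀ n : ℕ, 1 - a * q ^ n ≠ 0) :
    ∃ M, 0 ≤ M ∧ ∀ k n : ℕ, ‖(qPoch (a * q ^ k) q n)⁻¹‖ ≤ M := by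
  obtain ⟨A, hA0, hA⟩ := exists_norm_qPoch_le a hq
  obtain ⟨B, hB⟩ := ((tendsto_qPoch a hq).inv₀ (qPochInf_ne_zero hq h)).norm.bddAbove_range
  have hB' : ∀ n, ‖(qPoch a q n)⁻¹‖ ≤ B := fun n => hB ⟨n, rfl⟩
  refine ⟨A * B, mul_nonneg hA0 ((norm_nonneg _).trans (hB' 0)), fun k n => ?_⟩
  have h1 : (qPoch (a * q ^ k) q n)⁻¹ = qPoch a q k * (qPoch a q (k + n))⁻¹ := by
    have := qPoch_ne_zero h k
    rw [qPoch_add, mul_inv, mul_inv_cancel_left₀ this]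
  rw [h1, norm_mul]
  exact mul_le_mul (by simpa using hA 0 k) (hB' _) (norm_nonneg _) hA0

theorem tendsto_qPochInf_mul_pow {a q : ℂ} (hq : ‖q‖ < 1) (h : ∀ n : ℕ, 1 - a * q ^ n ≠ 0) :
    Filter.Tendsto (fun k : ℕ => qPochInf (a * q ^ k) q) Filter.atTop (nhds 1) := by
  have h0 := qPochInf_ne_zero hq h
  have h1 := (tendsto_qPoch a hq).inv₀ h0 |>.const_mul (qPochInf a q)
  rw [mul_inv_cancel₀ h0] at h1
  refine h1.congr fun k => ?_
  rw [qPochInf_eq_mul a hq k, mul_comm, inv_mul_cancel_left₀ (qPoch_ne_zero h k)]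

theorem exists_norm_qPochInf_le (a : ℂ) {q : ℂ} (hq : ‖q‖ < 1) :
    ∃ M, 0 ≤ M ∧ ∀ k : ℕ, ‖qPochInf (a * q ^ k) q‖ ≤ M := by
  obtain ⟨M, hM0, hM⟩ := exists_norm_qPoch_le a hq
  exact ⟨M, hM0, fun k => le_of_tendsto (tendsto_qPoch _ hq).norm
    (Filter.Eventually.of_forall fun n => hM k n)⟩

theorem exists_norm_inv_qPochInf_le {a q : ℂ} (hq : ‖q‖ < 1) (h : ∀ n : ℕ, 1 - a * q ^ n ≠ 0) :
    ∃ M, 0 ≤ M ∧ ∀ k : ℕ, ‖(qPochInf (a * q ^ k) q)⁻¹‖ ≤ M := by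
  obtain ⟨M, hM0, hM⟩ := exists_norm_inv_qPoch_le hq h
  refine ⟨M, hM0, fun k => le_of_tendsto
    (((tendsto_qPoch _ hq).inv₀ (qPochInf_ne_zero hq fun n => ?_)).norm)
    (Filter.Eventually.of_forall fun n => hM k n)⟩
  simpa [mul_assoc, pow_add] using h (k + n)

/-! ### Telescoping, iteration and summability tools. -/

theorem HasSum.eq_sub_of_telescope {f t : ℕ → ℂ} {a l : ℂ} (hf : HasSum f a)
    (ht : Filter.Tendsto t Filter.atTop (nhds l)) (h : ∀ n, f n = t (n + 1) - t n) :
    a = l - t 0 := by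
  refine tendsto_nhds_unique hf.tendsto_sum_nat ?_
  simp only [h, Finset.sum_range_sub]
  exact ht.sub_const _

/-- Uniqueness principle for q-difference equations: once `|c k| < 1/2`, iterating `j` times bounds
`f k` by `2^{-j} M` for every `j`, so `f` vanishes far out. -/
theorem eq_zero_of_eq_mul_succ {f c : ℕ → ℂ} {M : ℝ} (hM : ∀ k, ‖f k‖ ≤ M)
    (hc : Filter.Tendsto c Filter.atTop (nhds 0)) (h : ∀ k, f k = c k * f (k + 1)) :
    f 0 = 0 := by
  have hev : ∀ᶠ k in Filter.atTop, ‖c k‖ < 1 / 2 := by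
    have := hc.norm
    rw [norm_zero] at this
    exact this.eventually_lt_const (by norm_num)
  obtain ⟨K, hK⟩ := Filter.eventually_atTop.1 hev
  have h1 : ∀ j k, K ≤ k → ‖f k‖ ≤ (1 / 2) ^ j * M := by
    intro j
    induction j with
    | zero => intro k _; simpa using hM k
    | succ j ih =>
      intro k hk
      rw [h k, norm_mul, pow_succ', mul_assoc]
      exact mul_le_mul (hK k hk).le (ih _ (by omega)) (norm_nonneg _) (by norm_num)
  have h2 : f K = 0 := by
    rw [← norm_le_zero_iff]
    refine ge_of_tendsto' (x := Filter.atTop) (f := fun j : ℕ => (1 / 2 : ℝ) ^ j * M) ?_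
      fun j => h1 j K le_rfl
    simpa using (tendsto_pow_atTop_nhds_zero_of_lt_one (by norm_num : (0 : ℝ) ≤ 1 / 2)
      (by norm_num)).mul_const M
  clear h1 hK
  -- The recurrence carries the zero at `K` back down to `0`.
  induction K with
  | zero => exact h2
  | succ K ih => exact ih (by rw [h K, h2, mul_zero])

theorem summable_of_norm_le_mul_pow {f : ℕ → ℂ} {M r : ℝ} (hr0 : 0 ≤ r) (hr : r < 1)
    (h : ∀ n, ‖f n‖ ≤ M * r ^ n) : Summable f :=
  .of_norm_bounded ((summable_geometric_of_lt_one hr0 hr).mul_left M) h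

theorem norm_tsum_le_of_norm_le_mul_pow {f : ℕ → ℂ} {M r : ℝ} (hr0 : 0 ≤ r) (hr : r < 1)
    (h : ∀ n, ‖f n‖ ≤ M * r ^ n) : ‖∑' n, f n‖ ≤ ∑' n : ℕ, M * r ^ n :=
  tsum_of_norm_bounded ((summable_geometric_of_lt_one hr0 hr).mul_left M).hasSum h

theorem summable_theta (a : ℂ) {q : ℂ} (hq : ‖q‖ < 1) :
    Summable fun n : ℕ => a ^ n * q ^ (n + 1).choose 2 := by
  have h0 : Filter.Tendsto (fun n : ℕ => ‖a * q ^ (n + 1)‖) Filter.atTop (nhds 0) := by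
    have := ((tendsto_pow_atTop_nhds_zero_of_norm_lt_one hq).comp
      (Filter.tendsto_add_atTop_nat 1)).const_mul a |>.norm
    simpa [Function.comp_def] using this
  refine summable_of_ratio_norm_eventually_le (r := 1 / 2) (by norm_num) ?_
  filter_upwards [h0.eventually_lt_const (by norm_num : (0 : ℝ) < 1 / 2)] with n hn
  have : a ^ (n + 1) * q ^ (n + 1 + 1).choose 2 = a * q ^ (n + 1) * (a ^ n * q ^ (n + 1).choose 2) := by
    rw [Nat.choose_succ_succ' (n + 1) 1, Nat.choose_one_right]
    ring
  rw [this, norm_mul]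
  exact mul_le_mul_of_nonneg_right hn.le (norm_nonneg _)

/-! ### The four series in base `q`, with bounds uniform along `x q^k`. -/

/-- The term of the series in base `q` to which the smallest-part series reduces. -/
noncomputable def partsTerm (x u q : ℂ) (n : ℕ) : ℂ :=
  qPoch (x * u) q n * q ^ n / (qPoch (-u) q (n + 1) * qPoch x q (n + 1))

/-- The term of `ω₁` in base `q`. -/
noncomputable def mockTerm (x u q : ℂ) (n : ℕ) : ℂ :=
  q ^ n / (qPoch (-x) q (n + 1) * qPoch u q (n + 1))

/-- The term of the first correction series in base `q`, normalised to be `1 / (1 + x)` at `0`. -/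
noncomputable def fineTerm (x u q : ℂ) (n : ℕ) : ℂ :=
  qPoch (-(q / u)) q n * x ^ n / qPoch (-x) q (n + 1)

/-- The term of the partial theta series in base `q`. -/
noncomputable def thetaTerm (x u q : ℂ) (n : ℕ) : ℂ :=
  (x / u) ^ n * q ^ (n + 1).choose 2

theorem norm_mul_pow_lt_one {x q : ℂ} (hx : ‖x‖ < 1) (hq : ‖q‖ < 1) (k : ℕ) :
    ‖x * q ^ k‖ < 1 := by
  rw [norm_mul, norm_pow]
  exact (mul_le_of_le_one_right (norm_nonneg x) (pow_le_one₀ (norm_nonneg q) hq.le)).trans_lt hx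

theorem one_sub_neg_mul_pow_ne_zero {x q : ℂ} (hx : ‖x‖ < 1) (hq : ‖q‖ < 1) (n : ℕ) :
    1 - -x * q ^ n ≠ 0 :=
  one_sub_mul_pow_ne_zero (by rwa [norm_neg]) hq n

theorem exists_norm_partsTerm_le {x u q : ℂ} (hx : ‖x‖ < 1) (hq : ‖q‖ < 1)
    (hu : ∀ n : ℕ, 1 - -u * q ^ n ≠ 0) :
    ∃ M, ∀ k n : ℕ, ‖partsTerm (x * q ^ k) u q n‖ ≤ M * ‖q‖ ^ n := by
  obtain ⟨A, hA0, hA⟩ := exists_norm_qPoch_le (x * u) hq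
  obtain ⟨B, hB0, hB⟩ := exists_norm_inv_qPoch_le hq hu
  obtain ⟨C, hC0, hC⟩ := exists_norm_inv_qPoch_le hq (one_sub_mul_pow_ne_zero hx hq)
  refine ⟨A * B * C, fun k n => ?_⟩
  have hB' : ‖(qPoch (-u) q (n + 1))⁻¹‖ ≤ B := by simpa using hB 0 (n + 1)
  calc ‖partsTerm (x * q ^ k) u q n‖
      = ‖qPoch (x * u * q ^ k) q n‖ * ‖(qPoch (-u) q (n + 1))⁻¹‖ *
          ‖(qPoch (x * q ^ k) q (n + 1))⁻¹‖ * ‖q‖ ^ n := by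
        rw [partsTerm, mul_right_comm x, div_eq_mul_inv, mul_inv, norm_mul, norm_mul, norm_mul,
          norm_pow]
        ring
    _ ≤ A * B * C * ‖q‖ ^ n := by
        gcongr
        exacts [hA k n, hC k _]

theorem exists_norm_mockTerm_le {x u q : ℂ} (hx : ‖x‖ < 1) (hq : ‖q‖ < 1)
    (hu : ∀ n : ℕ, 1 - u * q ^ n ≠ 0) :
    ∃ M, ∀ k n : ℕ, ‖mockTerm (x * q ^ k) u q n‖ ≤ M * ‖q‖ ^ n := by
  obtain ⟨B, hB0, hB⟩ := exists_norm_inv_qPoch_le hq hu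
  obtain ⟨C, hC0, hC⟩ := exists_norm_inv_qPoch_le hq (one_sub_neg_mul_pow_ne_zero hx hq)
  refine ⟨B * C, fun k n => ?_⟩
  have hB' : ‖(qPoch u q (n + 1))⁻¹‖ ≤ B := by simpa using hB 0 (n + 1)
  calc ‖mockTerm (x * q ^ k) u q n‖
      = ‖(qPoch u q (n + 1))⁻¹‖ * ‖(qPoch (-x * q ^ k) q (n + 1))⁻¹‖ * ‖q‖ ^ n := by
        rw [mockTerm, neg_mul, div_eq_mul_inv, mul_inv, norm_mul, norm_mul, norm_pow]
        ring
    _ ≤ B * C * ‖q‖ ^ n := by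
        gcongr
        exact hC k _

theorem exists_norm_fineTerm_le {x q : ℂ} (u : ℂ) (hx : ‖x‖ < 1) (hq : ‖q‖ < 1) :
    ∃ M, ∀ k n : ℕ, ‖fineTerm (x * q ^ k) u q n‖ ≤ M * ‖x‖ ^ n := by
  obtain ⟨B, hB0, hB⟩ := exists_norm_qPoch_le (-(q / u)) hq
  obtain ⟨C, hC0, hC⟩ := exists_norm_inv_qPoch_le hq (one_sub_neg_mul_pow_ne_zero hx hq)
  refine ⟨B * C, fun k n => ?_⟩
  have hB' : ‖qPoch (-(q / u)) q n‖ ≤ B := by simpa using hB 0 n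
  have hxk : ‖x * q ^ k‖ ≤ ‖x‖ := by
    rw [norm_mul, norm_pow]
    exact mul_le_of_le_one_right (norm_nonneg x) (pow_le_one₀ (norm_nonneg q) hq.le)
  calc ‖fineTerm (x * q ^ k) u q n‖
      = ‖qPoch (-(q / u)) q n‖ * ‖(qPoch (-x * q ^ k) q (n + 1))⁻¹‖ * ‖x * q ^ k‖ ^ n := by
        rw [fineTerm, neg_mul x, div_eq_mul_inv, norm_mul, norm_mul, norm_pow]
        ring
    _ ≤ B * C * ‖x‖ ^ n := by
        gcongr
        exact hC k _

theorem summable_partsTerm {x u q : ℂ} (hx : ‖x‖ < 1) (hq : ‖q‖ < 1)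
    (hu : ∀ n : ℕ, 1 - -u * q ^ n ≠ 0) : Summable (partsTerm x u q) := by
  obtain ⟨M, hM⟩ := exists_norm_partsTerm_le hx hq hu
  exact summable_of_norm_le_mul_pow (norm_nonneg q) hq (by simpa using hM 0)

theorem summable_mockTerm {x u q : ℂ} (hx : ‖x‖ < 1) (hq : ‖q‖ < 1)
    (hu : ∀ n : ℕ, 1 - u * q ^ n ≠ 0) : Summable (mockTerm x u q) := by
  obtain ⟨M, hM⟩ := exists_norm_mockTerm_le hx hq hu
  exact summable_of_norm_le_mul_pow (norm_nonneg q) hq (by simpa using hM 0)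

theorem summable_fineTerm {x q : ℂ} (u : ℂ) (hx : ‖x‖ < 1) (hq : ‖q‖ < 1) :
    Summable (fineTerm x u q) := by
  obtain ⟨M, hM⟩ := exists_norm_fineTerm_le u hx hq
  exact summable_of_norm_le_mul_pow (norm_nonneg x) hx (by simpa using hM 0)

theorem summable_thetaTerm (x u : ℂ) {q : ℂ} (hq : ‖q‖ < 1) : Summable (thetaTerm x u q) :=
  summable_theta _ hq

/-- The shift multiplies the `n`-th term by `q^{kn}`, of norm at most `1`, so the unshifted series
dominates. -/
theorem exists_norm_tsum_thetaTerm_le (x u : ℂ) {q : ℂ} (hq : ‖q‖ < 1) :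
    ∃ M, ∀ k : ℕ, ‖∑' n, thetaTerm (x * q ^ k) u q n‖ ≤ M := by
  refine ⟨_, fun k => tsum_of_norm_bounded (summable_thetaTerm x u hq).norm.hasSum fun n => ?_⟩
  have h : thetaTerm (x * q ^ k) u q n = thetaTerm x u q n * (q ^ k) ^ n := by
    rw [thetaTerm, thetaTerm, mul_div_right_comm, mul_pow]
    ring
  rw [h, norm_mul, norm_pow, norm_pow]
  exact mul_le_of_le_one_right (norm_nonneg _)
    (pow_le_one₀ (by positivity) (pow_le_one₀ (norm_nonneg q) hq.le))

/-! ### First-order q-difference equations in `x`. -/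

/-- The combined terms are differences of `-(xu;q)_n / ((x;q)_{n+1} (-u;q)_n)`; its nonzero limit
supplies the infinite products on the right. -/
theorem tsum_partsTerm_rec {x u q : ℂ} (hx : ‖x‖ < 1) (hq : ‖q‖ < 1)
    (hu : ∀ n : ℕ, 1 - -u * q ^ n ≠ 0) :
    (1 + x) * u * ∑' n, partsTerm x u q n -
        x * q * (1 - x * u) / (1 - x) * ∑' n, partsTerm (x * q) u q n =
      1 / (1 - x) - qPochInf (x * u) q / (qPochInf x q * qPochInf (-u) q) := by
  have hxn := one_sub_mul_pow_ne_zero hx hq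
  have hxq : ‖x * q‖ < 1 := by simpa using norm_mul_pow_lt_one hx hq 1
  have hx1 : 1 - x ≠ 0 := by simpa using hxn 0
  have h := (((summable_partsTerm hx hq hu).hasSum.mul_left ((1 + x) * u)).sub
    ((summable_partsTerm hxq hq hu).hasSum.mul_left (x * q * (1 - x * u) / (1 - x))))
  have ht : Filter.Tendsto
      (fun n => -(qPoch (x * u) q n / (qPoch x q (n + 1) * qPoch (-u) q n))) Filter.atTop
      (nhds (-(qPochInf (x * u) q / (qPochInf x q * qPochInf (-u) q)))) :=
    ((tendsto_qPoch _ hq).div (((tendsto_qPoch x hq).comp (Filter.tendsto_add_atTop_nat 1)).mul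
      (tendsto_qPoch _ hq)) (mul_ne_zero (qPochInf_ne_zero hq hxn) (qPochInf_ne_zero hq hu))).neg
  rw [h.eq_sub_of_telescope ht fun n => ?_]
  · simp [qPoch_zero, qPoch_one]
    ring
  · have e1 : (1 - x * u) * qPoch (x * q * u) q n = qPoch (x * u) q n * (1 - x * u * q ^ n) := by
      rw [← qPoch_succ, qPoch_succ', mul_right_comm x]
    have e2 : (1 - x) * qPoch (x * q) q (n + 1) =
        qPoch x q n * (1 - x * q ^ n) * (1 - x * q ^ (n + 1)) := by
      rw [← qPoch_succ, ← qPoch_succ, ← qPoch_succ']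
    -- The prefactor is absorbed so that the Pochhammer symbols at `xq` become symbols at `x`; then
    -- only a rational identity in `y = q^n` remains.
    have e3 : x * q * (1 - x * u) / (1 - x) * partsTerm (x * q) u q n =
        x * q * (qPoch (x * u) q n * (1 - x * u * q ^ n)) * q ^ n /
          (qPoch (-u) q (n + 1) * (qPoch x q n * (1 - x * q ^ n) * (1 - x * q ^ (n + 1)))) := by
      rw [partsTerm, ← e1, ← e2, div_mul_div_comm]
      congr 1 <;> ring
    have n1 := hxn n
    have n2 := hxn (n + 1)
    have n3 := hu n
    have n4 := qPoch_ne_zero hxn n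
    have n5 := qPoch_ne_zero hu n
    rw [e3, partsTerm]
    simp only [qPoch_succ]
    simp only [pow_succ, ← mul_assoc, neg_mul, sub_neg_eq_add] at n2 n3 ⊢
    generalize q ^ n = y at n1 n2 n3 ⊢
    field_simp
    ring

/-- The telescoping sequence is `1 / ((-x;q)_{n+1} (u;q)_n)`. -/
theorem tsum_mockTerm_rec {x u q : ℂ} (hx : ‖x‖ < 1) (hq : ‖q‖ < 1)
    (hu : ∀ n : ℕ, 1 - u * q ^ n ≠ 0) :
    u * ∑' n, mockTerm x u q n - x * q / (1 + x) * ∑' n, mockTerm (x * q) u q n =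
      1 / (qPochInf (-x) q * qPochInf u q) - 1 / (1 + x) := by
  have hxn := one_sub_neg_mul_pow_ne_zero hx hq
  have hxq : ‖x * q‖ < 1 := by simpa using norm_mul_pow_lt_one hx hq 1
  have h := (((summable_mockTerm hx hq hu).hasSum.mul_left u).sub
    ((summable_mockTerm hxq hq hu).hasSum.mul_left (x * q / (1 + x))))
  have ht : Filter.Tendsto
      (fun n => 1 / (qPoch (-x) q (n + 1) * qPoch u q n)) Filter.atTop
      (nhds (1 / (qPochInf (-x) q * qPochInf u q))) :=
    tendsto_const_nhds.div (((tendsto_qPoch _ hq).comp (Filter.tendsto_add_atTop_nat 1)).mul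
      (tendsto_qPoch _ hq)) (mul_ne_zero (qPochInf_ne_zero hq hxn) (qPochInf_ne_zero hq hu))
  rw [h.eq_sub_of_telescope ht fun n => ?_]
  · simp [qPoch_zero, qPoch_one]
  · have e2 : (1 + x) * qPoch (-(x * q)) q (n + 1) =
        qPoch (-x) q n * (1 - -x * q ^ n) * (1 - -x * q ^ (n + 1)) := by
      rw [← qPoch_succ, ← qPoch_succ, qPoch_succ' (-x) q (n + 1), neg_mul, sub_neg_eq_add]
    have e3 : x * q / (1 + x) * mockTerm (x * q) u q n = x * q * q ^ n /
        (qPoch u q (n + 1) * (qPoch (-x) q n * (1 - -x * q ^ n) * (1 - -x * q ^ (n + 1)))) := by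
      rw [mockTerm, ← e2, div_mul_div_comm]
      congr 1; ring
    have n1 := hxn n
    have n2 := hxn (n + 1)
    have n3 := hu n
    have n4 := qPoch_ne_zero hxn n
    have n5 := qPoch_ne_zero hu n
    rw [e3, mockTerm]
    simp only [qPoch_succ]
    simp only [pow_succ, ← mul_assoc, neg_mul, sub_neg_eq_add] at n1 n2 n3 ⊢
    generalize q ^ n = y at n1 n2 n3 ⊢
    -- Naming the denominators keeps them atomic while fractions are cleared; only `e` must be
    -- expanded for the final polynomial identity.
    obtain ⟨d, hd⟩ : ∃ d, d = 1 + x * y := ⟨_, rfl⟩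
    obtain ⟨e, he⟩ : ∃ e, e = 1 + x * y * q := ⟨_, rfl⟩
    rw [← hd] at n1
    rw [← he] at n2
    rw [← hd, ← he]
    field_simp
    rw [he]
    ring

/-- Here the telescoping sequence is `-fineTerm` itself, which tends to `0`, so only the initial
term survives. -/
theorem tsum_fineTerm_rec {x u q : ℂ} (hx : ‖x‖ < 1) (hq : ‖q‖ < 1) (hu0 : u ≠ 0) :
    (1 - x) * ∑' n, fineTerm x u q n -
        x * q * (1 - x * u) / (u * (1 + x)) * ∑' n, fineTerm (x * q) u q n = 1 / (1 + x) := by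
  have hxn := one_sub_neg_mul_pow_ne_zero hx hq
  have hxq : ‖x * q‖ < 1 := by simpa using norm_mul_pow_lt_one hx hq 1
  have h := (((summable_fineTerm u hx hq).hasSum.mul_left (1 - x)).sub
    ((summable_fineTerm u hxq hq).hasSum.mul_left (x * q * (1 - x * u) / (u * (1 + x)))))
  rw [h.eq_sub_of_telescope (summable_fineTerm u hx hq).tendsto_atTop_zero.neg fun n => ?_]
  · simp [fineTerm, qPoch_zero, qPoch_one]
  · have e2 : (1 + x) * qPoch (-(x * q)) q (n + 1) =
        qPoch (-x) q n * (1 - -x * q ^ n) * (1 - -x * q ^ (n + 1)) := by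
      rw [← qPoch_succ, ← qPoch_succ, qPoch_succ' (-x) q (n + 1), neg_mul, sub_neg_eq_add]
    have e3 : x * q * (1 - x * u) / (u * (1 + x)) * fineTerm (x * q) u q n =
        x * q * (1 - x * u) * (qPoch (-(q / u)) q n * (x * q) ^ n) /
        (u * (qPoch (-x) q n * (1 - -x * q ^ n) * (1 - -x * q ^ (n + 1)))) := by
      rw [fineTerm, ← e2, div_mul_div_comm]
      congr 1; ring
    have n1 := hxn n
    have n2 := hxn (n + 1)
    have n4 := qPoch_ne_zero hxn n
    rw [e3, fineTerm, fineTerm]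
    simp only [qPoch_succ]
    simp only [pow_succ, ← mul_assoc, neg_mul, sub_neg_eq_add, mul_pow] at n1 n2 ⊢
    generalize q ^ n = y at n1 n2 ⊢
    obtain ⟨d, hd⟩ : ∃ d, d = 1 + x * y := ⟨_, rfl⟩
    obtain ⟨e, he⟩ : ∃ e, e = 1 + x * y * q := ⟨_, rfl⟩
    rw [← hd] at n1
    rw [← he] at n2
    rw [← hd, ← he]
    field_simp
    rw [he]
    ring

theorem tsum_thetaTerm_rec (x u : ℂ) {q : ℂ} (hq : ‖q‖ < 1) :
    ∑' n, thetaTerm x u q n - x * q / u * ∑' n, thetaTerm (x * q) u q n = 1 := by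
  have h := ((summable_thetaTerm x u hq).hasSum.sub
    ((summable_thetaTerm (x * q) u hq).hasSum.mul_left (x * q / u)))
  rw [h.eq_sub_of_telescope (summable_thetaTerm x u hq).tendsto_atTop_zero.neg fun n => ?_]
  · simp [thetaTerm]
  · have : (n + 1 + 1).choose 2 = n + 1 + (n + 1).choose 2 := by
      rw [Nat.choose_succ_succ' (n + 1) 1, Nat.choose_one_right]
    simp only [thetaTerm, this, div_pow, mul_pow]
    ring

/-! ### Vanishing of the defect. -/

/-- The difference of the two sides of the trivariate identity in base `q`, multiplied by `u`. -/
noncomputable def partsDefect (x u q : ℂ) : ℂ :=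
  u * ∑' n, partsTerm x u q n - ∑' n, fineTerm x u q n -
    qPochInf (x * u) q / (qPochInf x q * qPochInf (-u) q) *
      (u * ∑' n, mockTerm x u q n -
        1 / (qPochInf (-x) q * qPochInf u q) * ∑' n, thetaTerm x u q n)

/-- With `P = (xu)_∞ / ((x)_∞ (-u)_∞)`, the equation for `partsTerm` leaves `1/(1-x²) - P/(1+x)`.
The first part cancels against `fineTerm`. The second cancels against `mockTerm`, whose other
residue is removed by the theta equation. -/
theorem partsDefect_rec {x u q : ℂ} (hx : ‖x‖ < 1) (hq : ‖q‖ < 1) (hu0 : u ≠ 0)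
    (hu : ∀ n : ℕ, 1 - u * q ^ n ≠ 0) (hu' : ∀ n : ℕ, 1 - -u * q ^ n ≠ 0) :
    partsDefect x u q =
      x * q * (1 - x * u) / (u * ((1 - x) * (1 + x))) * partsDefect (x * q) u q := by
  have hxq : ‖x * q‖ < 1 := by simpa using norm_mul_pow_lt_one hx hq 1
  have n1 : 1 - x ≠ 0 := by simpa using one_sub_mul_pow_ne_zero hx hq 0
  have n2 : 1 + x ≠ 0 := by simpa using one_sub_neg_mul_pow_ne_zero hx hq 0
  have a1 := qPochInf_ne_zero hq (one_sub_mul_pow_ne_zero hxq hq)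
  have a2 := qPochInf_ne_zero hq (one_sub_neg_mul_pow_ne_zero hxq hq)
  have a3 := qPochInf_ne_zero hq hu
  have a4 := qPochInf_ne_zero hq hu'
  have r1 := tsum_partsTerm_rec hx hq hu'
  have r2 := tsum_mockTerm_rec hx hq hu
  have r3 := tsum_fineTerm_rec hx hq hu0
  have r4 := tsum_thetaTerm_rec x u hq
  rw [qPochInf_succ (x * u) hq, qPochInf_succ x hq] at r1
  rw [qPochInf_succ (-x) hq] at r2
  rw [partsDefect, partsDefect, qPochInf_succ (x * u) hq, qPochInf_succ x hq,
    qPochInf_succ (-x) hq]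
  rw [neg_mul, sub_neg_eq_add] at r2 ⊢
  rw [mul_right_comm x u q] at r1 ⊢
  generalize ∑' n, partsTerm x u q n = S at *
  generalize ∑' n, partsTerm (x * q) u q n = S' at *
  generalize ∑' n, mockTerm x u q n = W at *
  generalize ∑' n, mockTerm (x * q) u q n = W' at *
  generalize ∑' n, fineTerm x u q n = T at *
  generalize ∑' n, fineTerm (x * q) u q n = T' at *
  generalize ∑' n, thetaTerm x u q n = Θ at *
  generalize ∑' n, thetaTerm (x * q) u q n = Θ' at *
  generalize qPochInf (x * q * u) q = A at *
  generalize qPochInf (x * q) q = B at *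
  generalize qPochInf (-(x * q)) q = C at *
  generalize qPochInf u q = D at *
  generalize qPochInf (-u) q = F at *
  have s1 : u * S = (x * q * (1 - x * u) / (1 - x) * S' +
      (1 / (1 - x) - (1 - x * u) * A / ((1 - x) * B * F))) / (1 + x) := by
    rw [eq_div_iff n2]
    linear_combination r1
  have s2 : u * W = x * q / (1 + x) * W' + (1 / ((1 + x) * C * D) - 1 / (1 + x)) := by
    linear_combination r2
  have s3 : T = (x * q * (1 - x * u) / (u * (1 + x)) * T' + 1 / (1 + x)) / (1 - x) := by
    rw [eq_div_iff n1]
    linear_combination r3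
  have s4 : Θ = 1 + x * q / u * Θ' := by linear_combination r4
  rw [s1, s2, s3, s4]
  field_simp
  ring

theorem exists_norm_tsum_le {f : ℕ → ℕ → ℂ} {r : ℝ} (hr0 : 0 ≤ r) (hr : r < 1)
    (h : ∃ M, ∀ k n, ‖f k n‖ ≤ M * r ^ n) : ∃ M, ∀ k, ‖∑' n, f k n‖ ≤ M :=
  let ⟨_, hM⟩ := h
  ⟨_, fun k => norm_tsum_le_of_norm_le_mul_pow hr0 hr (hM k)⟩

theorem exists_norm_partsDefect_le {x u q : ℂ} (hx : ‖x‖ < 1) (hq : ‖q‖ < 1)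
    (hu : ∀ n : ℕ, 1 - u * q ^ n ≠ 0) (hu' : ∀ n : ℕ, 1 - -u * q ^ n ≠ 0) :
    ∃ M, ∀ k : ℕ, ‖partsDefect (x * q ^ k) u q‖ ≤ M := by
  obtain ⟨S, hS⟩ := exists_norm_tsum_le (norm_nonneg q) hq (exists_norm_partsTerm_le hx hq hu')
  obtain ⟨W, hW⟩ := exists_norm_tsum_le (norm_nonneg q) hq (exists_norm_mockTerm_le hx hq hu)
  obtain ⟨T, hT⟩ := exists_norm_tsum_le (norm_nonneg x) hx (exists_norm_fineTerm_le u hx hq)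
  obtain ⟨Θ, hΘ⟩ := exists_norm_tsum_thetaTerm_le x u hq
  obtain ⟨A, hA0, hA⟩ := exists_norm_qPochInf_le (x * u) hq
  obtain ⟨B, hB0, hB⟩ := exists_norm_inv_qPochInf_le hq (one_sub_mul_pow_ne_zero hx hq)
  obtain ⟨C, hC0, hC⟩ := exists_norm_inv_qPochInf_le hq (one_sub_neg_mul_pow_ne_zero hx hq)
  refine ⟨‖u‖ * S + T + A * (B * ‖(qPochInf (-u) q)⁻¹‖) *
    (‖u‖ * W + C * ‖(qPochInf u q)⁻¹‖ * Θ), fun k => ?_⟩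
  rw [partsDefect]
  refine (norm_sub_le _ _).trans (add_le_add ((norm_sub_le _ _).trans (add_le_add ?_ (hT k))) ?_)
  · rw [norm_mul]
    gcongr
    exact hS k
  · rw [norm_mul, div_eq_mul_inv, mul_inv, norm_mul, norm_mul, mul_right_comm x]
    gcongr
    · exact hA k
    · exact hB k
    · refine (norm_sub_le _ _).trans (add_le_add ?_ ?_)
      · rw [norm_mul]
        gcongr
        exact hW k
      · rw [norm_mul, one_div, mul_inv, norm_mul, ← neg_mul]
        gcongr
        · exact hC k
        · exact hΘ k

theorem partsDefect_eq_zero {x u q : ℂ} (hx : ‖x‖ < 1) (hq : ‖q‖ < 1) (hu0 : u ≠ 0)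
    (hu : ∀ n : ℕ, 1 - u * q ^ n ≠ 0) (hu' : ∀ n : ℕ, 1 - -u * q ^ n ≠ 0) :
    partsDefect x u q = 0 := by
  obtain ⟨M, hM⟩ := exists_norm_partsDefect_le hx hq hu hu'
  have hk : Filter.Tendsto (fun k : ℕ => x * q ^ k) Filter.atTop (nhds 0) := by
    simpa using (tendsto_pow_atTop_nhds_zero_of_norm_lt_one hq).const_mul x
  have hc : ContinuousAt (fun y : ℂ => y * q * (1 - y * u) / (u * ((1 - y) * (1 + y)))) 0 :=
    ContinuousAt.div (by fun_prop) (by fun_prop) (by simpa using hu0)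
  have hc' := hc.tendsto.comp hk
  simp only [zero_mul, zero_div] at hc'
  simpa using eq_zero_of_eq_mul_succ hM hc' fun k => by
    rw [partsDefect_rec (norm_mul_pow_lt_one hx hq k) hq hu0 hu hu']
    simp only [Function.comp_apply, pow_succ, ← mul_assoc]

theorem tsum_partsTerm {x u q : ℂ} (hx : ‖x‖ < 1) (hq : ‖q‖ < 1) (hu0 : u ≠ 0)
    (hu : ∀ n : ℕ, 1 - u * q ^ n ≠ 0) (hu' : ∀ n : ℕ, 1 - -u * q ^ n ≠ 0) :
    u * ∑' n, partsTerm x u q n = ∑' n, fineTerm x u q n +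
      qPochInf (x * u) q / (qPochInf x q * qPochInf (-u) q) *
        (u * ∑' n, mockTerm x u q n -
          1 / (qPochInf (-x) q * qPochInf u q) * ∑' n, thetaTerm x u q n) := by
  have h := partsDefect_eq_zero hx hq hu0 hu hu'
  rw [partsDefect] at h
  linear_combination h

/-! ### The diagonal case `u = x`. -/

/-- The terms of `fineTerm` at `u = x`, written so that they make sense at `x = 0`. -/
noncomputable def diagTerm (x q : ℂ) (m : ℕ) : ℂ :=
  (∏ j ∈ Finset.range (m + 1), (x + q ^ j)) / qPoch (-x) q (m + 1)

/-- The majorant is built from `∏ (|x| + |q|^j)`, whose successive ratios tend to `|x| < 1`. It does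
not depend on `k`, as dominated convergence needs. -/
theorem exists_bound_diagTerm {x q : ℂ} (hx : ‖x‖ < 1) (hq : ‖q‖ < 1) :
    ∃ b : ℕ → ℝ, Summable b ∧ ∀ k m : ℕ, ‖diagTerm (x * q ^ k) q m‖ ≤ b m := by
  obtain ⟨C, hC0, hC⟩ := exists_norm_inv_qPoch_le hq (one_sub_neg_mul_pow_ne_zero hx hq)
  refine ⟨fun m => (∏ j ∈ Finset.range (m + 1), (‖x‖ + ‖q‖ ^ j)) * C, Summable.mul_right _ ?_,
    fun k m => ?_⟩
  · obtain ⟨r, hr0, hr⟩ := exists_between hx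
    have h0 : Filter.Tendsto (fun n : ℕ => ‖x‖ + ‖q‖ ^ (n + 1)) Filter.atTop (nhds ‖x‖) := by
      simpa using ((tendsto_pow_atTop_nhds_zero_of_lt_one (norm_nonneg q) hq).comp
        (Filter.tendsto_add_atTop_nat 1)).const_add ‖x‖
    refine summable_of_ratio_norm_eventually_le hr ?_
    filter_upwards [h0.eventually_lt_const hr0] with n hn
    rw [Finset.prod_range_succ _ (n + 1), norm_mul, mul_comm]
    refine mul_le_mul_of_nonneg_right ?_ (norm_nonneg _)
    rw [Real.norm_of_nonneg (by positivity)]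
    exact hn.le
  · have hxk : ‖x * q ^ k‖ ≤ ‖x‖ := by
      rw [norm_mul, norm_pow]
      exact mul_le_of_le_one_right (norm_nonneg x) (pow_le_one₀ (norm_nonneg q) hq.le)
    rw [diagTerm, div_eq_mul_inv, norm_mul, norm_prod, ← neg_mul]
    beta_reduce
    gcongr with j
    · refine (norm_add_le _ _).trans ?_
      rw [norm_pow]
      gcongr
    · exact hC k _

theorem summable_diagTerm {x q : ℂ} (hx : ‖x‖ < 1) (hq : ‖q‖ < 1) : Summable (diagTerm x q) := by
  obtain ⟨b, hb, h⟩ := exists_bound_diagTerm hx hq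
  exact .of_norm_bounded hb (by simpa using h 0)

theorem tsum_diagTerm_rec {x q : ℂ} (hx : ‖x‖ < 1) (hq : ‖q‖ < 1) :
    (1 - x ^ 2 * q) * ∑' n, diagTerm (x * q) q n =
      (1 - x) * (1 + x * q) * ∑' n, diagTerm x q n := by
  have hxn := one_sub_neg_mul_pow_ne_zero hx hq
  have hxq : ‖x * q‖ < 1 := by simpa using norm_mul_pow_lt_one hx hq 1
  have h := ((summable_diagTerm hxq hq).hasSum.mul_left (1 - x ^ 2 * q)).sub
    ((summable_diagTerm hx hq).hasSum.mul_left ((1 - x) * (1 + x * q)))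
  -- The factor `1 - q^m` makes the telescoping sequence vanish at `m = 0`; as its limit is also
  -- `0`, the resulting equation is homogeneous.
  have ht : Filter.Tendsto (fun m => (1 + x * q) * (x * (1 - q ^ m)) *
      ((∏ j ∈ Finset.range m, (x + q ^ j)) / qPoch (-x) q (m + 1))) Filter.atTop (nhds 0) := by
    -- After a shift by one, the quotient is `diagTerm` over one further factor that tends to `1`.
    rw [← Filter.tendsto_add_atTop_iff_nat 1]
    have hq' := (tendsto_pow_atTop_nhds_zero_of_norm_lt_one hq).comp
      (Filter.tendsto_add_atTop_nat 1)
    have h1 := (((hq'.const_sub 1).const_mul x).const_mul (1 + x * q)).mul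
      ((summable_diagTerm hx hq).tendsto_atTop_zero.div ((hq'.const_mul (-x)).const_sub 1)
        (by simp))
    simp only [zero_div, mul_zero] at h1
    refine h1.congr fun m => ?_
    simp only [Function.comp_apply, Pi.div_apply, diagTerm, qPoch_succ _ _ (m + 1), div_div]
  have h2 := h.eq_sub_of_telescope ht fun m => ?_
  · simp only [pow_zero, sub_self, mul_zero, zero_mul] at h2
    exact sub_eq_zero.1 h2
  · have e1 : ∏ j ∈ Finset.range (m + 1), (x * q + q ^ j) =
        (∏ j ∈ Finset.range m, (x + q ^ j)) * q ^ m * (1 + x * q) := by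
      rw [Finset.prod_range_succ', pow_zero, add_comm (x * q) 1]
      congr 1
      simp only [show ∀ j, x * q + q ^ (j + 1) = (x + q ^ j) * q from fun j => by ring,
        Finset.prod_mul_distrib, Finset.prod_const, Finset.card_range]
    have e2 : qPoch (-(x * q)) q (m + 1) =
        qPoch (-x) q m * (1 - -x * q ^ m) * (1 - -x * q ^ (m + 1)) / (1 + x) := by
      rw [eq_div_iff (by simpa using hxn 0), ← qPoch_succ, ← qPoch_succ,
        qPoch_succ' (-x) q (m + 1), neg_mul, sub_neg_eq_add, mul_comm]
    have n0 : 1 + x ≠ 0 := by simpa using hxn 0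
    have n1 := hxn m
    have n2 := hxn (m + 1)
    have n4 := qPoch_ne_zero hxn m
    rw [diagTerm, diagTerm, e1, e2]
    simp only [qPoch_succ, Finset.prod_range_succ]
    simp only [pow_succ, ← mul_assoc, neg_mul, sub_neg_eq_add] at n1 n2 ⊢
    generalize ∏ j ∈ Finset.range m, (x + q ^ j) = N
    generalize q ^ m = y at n1 n2 ⊢
    obtain ⟨d, hd⟩ : ∃ d, d = 1 + x * y := ⟨_, rfl⟩
    obtain ⟨e, he⟩ : ∃ e, e = 1 + x * y * q := ⟨_, rfl⟩
    rw [← hd] at n1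
    rw [← he] at n2
    rw [← hd, ← he]
    field_simp
    rw [he]
    ring

theorem diagTerm_zero (q : ℂ) (m : ℕ) : diagTerm 0 q m = q ^ (m + 1).choose 2 := by
  simp only [diagTerm, zero_add, neg_zero, qPoch, zero_mul, sub_zero, Finset.prod_const_one, div_one]
  rw [Finset.prod_pow_eq_pow_sum _ (fun i => i), Finset.sum_range_id, Nat.choose_two_right]

theorem tendsto_tsum_diagTerm {x q : ℂ} (hx : ‖x‖ < 1) (hq : ‖q‖ < 1) :
    Filter.Tendsto (fun k : ℕ => ∑' m, diagTerm (x * q ^ k) q m) Filter.atTop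
      (nhds (∑' m : ℕ, q ^ (m + 1).choose 2)) := by
  obtain ⟨b, hb, h⟩ := exists_bound_diagTerm hx hq
  refine tendsto_tsum_of_dominated_convergence hb (fun m => ?_)
    (Filter.Eventually.of_forall fun k m => h k m)
  have hk : Filter.Tendsto (fun k : ℕ => x * q ^ k) Filter.atTop (nhds 0) := by
    simpa using (tendsto_pow_atTop_nhds_zero_of_norm_lt_one hq).const_mul x
  have hc : ContinuousAt (fun y : ℂ => diagTerm y q m) 0 := by
    unfold diagTerm qPoch
    exact ContinuousAt.div (by fun_prop) (by fun_prop) (by simp)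
  rw [← diagTerm_zero]
  exact hc.tendsto.comp hk

/-- The product `g` below solves the same homogeneous equation as the sum. The quotient is therefore
constant along `xq^k`, and it is evaluated in the limit `x → 0`, where `g → 1`. -/
theorem tsum_diagTerm {x q : ℂ} (hx : ‖x‖ < 1) (hq : ‖q‖ < 1) :
    ∑' m, diagTerm x q m = (1 + x) * (qPochInf (x ^ 2) q /
      (qPochInf x q * qPochInf (-x) q) ^ 2) * ∑' m : ℕ, q ^ (m + 1).choose 2 := by
  have hxn := one_sub_mul_pow_ne_zero hx hq
  have hxn' := one_sub_neg_mul_pow_ne_zero hx hq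
  have hx2n := one_sub_mul_pow_ne_zero (norm_sq_lt_one hx) hq
  set g : ℂ → ℂ := fun y => (1 + y) * (qPochInf (y ^ 2) q /
    (qPochInf y q * qPochInf (-y) q) ^ 2) with hg
  have hg_ne : ∀ y, ‖y‖ < 1 → g y ≠ 0 := fun y hy => by
    have n0 : 1 + y ≠ 0 := by simpa using one_sub_neg_mul_pow_ne_zero hy hq 0
    have a0 := qPochInf_ne_zero hq (one_sub_mul_pow_ne_zero hy hq)
    have a1 := qPochInf_ne_zero hq (one_sub_neg_mul_pow_ne_zero hy hq)
    have a2 := qPochInf_ne_zero hq (one_sub_mul_pow_ne_zero (norm_sq_lt_one hy) hq)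
    simp only [hg]
    positivity
  have hg_rec : ∀ y, ‖y‖ < 1 → (1 - y ^ 2 * q) * g (y * q) = (1 - y) * (1 + y * q) * g y := by
    intro y hy
    have hyq : ‖y * q‖ < 1 := by simpa using norm_mul_pow_lt_one hy hq 1
    have n0 : 1 + y ≠ 0 := by simpa using one_sub_neg_mul_pow_ne_zero hy hq 0
    have n1 : 1 - y ≠ 0 := by simpa using one_sub_mul_pow_ne_zero hy hq 0
    have a0 := qPochInf_ne_zero hq (one_sub_mul_pow_ne_zero hyq hq)
    have a1 := qPochInf_ne_zero hq (one_sub_neg_mul_pow_ne_zero hyq hq)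
    simp only [hg]
    rw [qPochInf_succ (y ^ 2) hq, qPochInf_succ (y ^ 2 * q) hq, qPochInf_succ y hq,
      qPochInf_succ (-y) hq, neg_mul, sub_neg_eq_add, show y ^ 2 * q * q = (y * q) ^ 2 by ring]
    field_simp
    ring
  have hconst : ∀ k : ℕ, (∑' m, diagTerm (x * q ^ k) q m) / g (x * q ^ k) =
      (∑' m, diagTerm x q m) / g x := by
    intro k
    induction k with
    | zero => simp
    | succ k ih =>
      have hy := norm_mul_pow_lt_one hx hq k
      have hyq := norm_mul_pow_lt_one hx hq (k + 1)
      rw [← ih]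
      rw [pow_succ, ← mul_assoc] at hyq ⊢
      have n1 : 1 - (x * q ^ k) ^ 2 * q ≠ 0 := by
        simpa using one_sub_mul_pow_ne_zero (norm_sq_lt_one hy) hq 1
      rw [div_eq_div_iff (hg_ne _ hyq) (hg_ne _ hy)]
      refine mul_left_cancel₀ n1 ?_
      linear_combination (g (x * q ^ k)) * tsum_diagTerm_rec hy hq -
        (∑' m, diagTerm (x * q ^ k) q m) * hg_rec _ hy
  have hlim : Filter.Tendsto (fun k : ℕ => g (x * q ^ k)) Filter.atTop (nhds 1) := by
    have hk : Filter.Tendsto (fun k : ℕ => x * q ^ k) Filter.atTop (nhds 0) := by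
      simpa using (tendsto_pow_atTop_nhds_zero_of_norm_lt_one hq).const_mul x
    have h2 := (tendsto_qPochInf_mul_pow hq hx2n).comp
      (Filter.tendsto_id.const_mul_atTop' (two_pos (α := ℕ)))
    have h3 := (hk.const_add 1).mul (h2.div (((tendsto_qPochInf_mul_pow hq hxn).mul
      (tendsto_qPochInf_mul_pow hq hxn')).pow 2) (by simp))
    simp only [add_zero, mul_one, one_pow, div_one] at h3
    refine h3.congr fun k => ?_
    simp only [hg, Function.comp_apply, Pi.div_apply, id, neg_mul, mul_pow, ← pow_mul, mul_comm k 2]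
  have hfin := (tendsto_tsum_diagTerm hx hq).div hlim one_ne_zero
  rw [div_one] at hfin
  have := tendsto_nhds_unique (hfin.congr hconst) tendsto_const_nhds
  rw [this, mul_div_cancel₀ _ (hg_ne x hx)]

theorem diagTerm_eq {x : ℂ} (hx0 : x ≠ 0) (q : ℂ) (m : ℕ) :
    diagTerm x q m = (1 + x) * fineTerm x x q m := by
  have h : ∏ j ∈ Finset.range (m + 1), (x + q ^ j) =
      (1 + x) * (qPoch (-(q / x)) q m * x ^ m) := by
    rw [Finset.prod_range_succ', pow_zero, mul_comm, add_comm x 1, qPoch]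
    congr 1
    have hj : ∀ j, x + q ^ (j + 1) = (1 - -(q / x) * q ^ j) * x := fun j => by
      field_simp
      ring
    simp only [hj, Finset.prod_mul_distrib, Finset.prod_const, Finset.card_range]
  rw [diagTerm, h, fineTerm, mul_div_assoc]

theorem tsum_fineTerm_self {x q : ℂ} (hx0 : x ≠ 0) (hx : ‖x‖ < 1) (hq : ‖q‖ < 1) :
    ∑' m, fineTerm x x q m = qPochInf (x ^ 2) q / (qPochInf x q * qPochInf (-x) q) ^ 2 *
      ∑' m, thetaTerm x x q m := by
  have n0 : 1 + x ≠ 0 := by simpa using one_sub_neg_mul_pow_ne_zero hx hq 0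
  refine mul_left_cancel₀ n0 ?_
  have h := tsum_diagTerm hx hq
  simp only [diagTerm_eq hx0, tsum_mul_left] at h
  simp only [h, thetaTerm, div_self hx0, one_pow, one_mul, mul_assoc]

/-- On the diagonal the `fineTerm` sum exactly cancels the theta contribution, leaving only the mock
series. -/
theorem tsum_partsTerm_self {x q : ℂ} (hx0 : x ≠ 0) (hx : ‖x‖ < 1) (hq : ‖q‖ < 1) :
    ∑' n, partsTerm x x q n = qPochInf (x ^ 2) q / qPochInf (x ^ 2) (q ^ 2) *
      ∑' n, mockTerm x x q n := by
  have h := tsum_partsTerm hx hq hx0 (one_sub_mul_pow_ne_zero hx hq)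
    (one_sub_neg_mul_pow_ne_zero hx hq)
  have a0 := qPochInf_ne_zero hq (one_sub_mul_pow_ne_zero hx hq)
  have a1 := qPochInf_ne_zero hq (one_sub_neg_mul_pow_ne_zero hx hq)
  rw [tsum_fineTerm_self hx0 hx hq, ← pow_two] at h
  rw [← qPochInf_mul_qPochInf_neg x hq]
  refine mul_left_cancel₀ hx0 (h.trans ?_)
  field_simp
  ring

/-! ### A Rogers–Fine transformation. -/

/-- The term of the series `∑ tⁿ / (b;p)_{n+1}`. -/
noncomputable def geomTerm (b t p : ℂ) (n : ℕ) : ℂ := t ^ n / qPoch b p (n + 1)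

/-- The term of the Rogers–Fine transform of `∑ tⁿ / (b;p)_{n+1}`. -/
noncomputable def rogersFineTerm (b t p : ℂ) (n : ℕ) : ℂ :=
  b ^ n * t ^ n * p ^ n ^ 2 / (qPoch b p (n + 1) * qPoch t p (n + 1))

theorem exists_norm_geomTerm_le {b t p : ℂ} (hb : ‖b‖ < 1) (hp : ‖p‖ < 1) :
    ∃ M, ∀ k n : ℕ, ‖geomTerm (b * p ^ k) (t * p ^ k) p n‖ ≤ M * ‖t‖ ^ n := by
  obtain ⟨C, hC0, hC⟩ := exists_norm_inv_qPoch_le hp (one_sub_mul_pow_ne_zero hb hp)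
  refine ⟨C, fun k n => ?_⟩
  have ht : ‖t * p ^ k‖ ≤ ‖t‖ := by
    rw [norm_mul, norm_pow]
    exact mul_le_of_le_one_right (norm_nonneg t) (pow_le_one₀ (norm_nonneg p) hp.le)
  rw [geomTerm, div_eq_mul_inv, norm_mul, norm_pow, mul_comm]
  gcongr
  exact hC k _

theorem exists_norm_rogersFineTerm_le {b t p : ℂ} (hb : ‖b‖ < 1) (ht : ‖t‖ < 1) (hp : ‖p‖ < 1) :
    ∃ M, ∀ k n : ℕ, ‖rogersFineTerm (b * p ^ k) (t * p ^ k) p n‖ ≤ M * ‖t‖ ^ n := by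
  obtain ⟨B, hB0, hB⟩ := exists_norm_inv_qPoch_le hp (one_sub_mul_pow_ne_zero hb hp)
  obtain ⟨C, hC0, hC⟩ := exists_norm_inv_qPoch_le hp (one_sub_mul_pow_ne_zero ht hp)
  refine ⟨B * C, fun k n => ?_⟩
  have h1 : ‖t * p ^ k‖ ≤ ‖t‖ := by
    rw [norm_mul, norm_pow]
    exact mul_le_of_le_one_right (norm_nonneg t) (pow_le_one₀ (norm_nonneg p) hp.le)
  have h2 : ‖b * p ^ k‖ ≤ 1 := (norm_mul_pow_lt_one hb hp k).le
  calc ‖rogersFineTerm (b * p ^ k) (t * p ^ k) p n‖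
      = ‖(qPoch (b * p ^ k) p (n + 1))⁻¹‖ * ‖(qPoch (t * p ^ k) p (n + 1))⁻¹‖ *
          (‖b * p ^ k‖ ^ n * ‖t * p ^ k‖ ^ n * ‖p‖ ^ n ^ 2) := by
        rw [rogersFineTerm, div_eq_mul_inv, mul_inv, norm_mul, norm_mul, norm_mul, norm_mul,
          norm_pow, norm_pow, norm_pow, mul_comm]
    _ ≤ B * C * (1 ^ n * ‖t‖ ^ n * 1) := by
        gcongr
        exacts [hB k _, hC k _, pow_le_one₀ (norm_nonneg p) hp.le]
    _ = B * C * ‖t‖ ^ n := by ring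

theorem summable_geomTerm {b t p : ℂ} (hb : ‖b‖ < 1) (ht : ‖t‖ < 1) (hp : ‖p‖ < 1) :
    Summable (geomTerm b t p) := by
  obtain ⟨M, hM⟩ := exists_norm_geomTerm_le (t := t) hb hp
  exact summable_of_norm_le_mul_pow (norm_nonneg t) ht (by simpa using hM 0)

theorem summable_rogersFineTerm {b t p : ℂ} (hb : ‖b‖ < 1) (ht : ‖t‖ < 1) (hp : ‖p‖ < 1) :
    Summable (rogersFineTerm b t p) := by
  obtain ⟨M, hM⟩ := exists_norm_rogersFineTerm_le hb ht hp
  exact summable_of_norm_le_mul_pow (norm_nonneg t) ht (by simpa using hM 0)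

theorem tsum_geomTerm_rec {b t p : ℂ} (hb : ‖b‖ < 1) (ht : ‖t‖ < 1) (hp : ‖p‖ < 1) :
    (1 - t) * ∑' n, geomTerm b t p n -
      b * t * p / (1 - b) * ∑' n, geomTerm (b * p) (t * p) p n = 1 / (1 - b) := by
  have hbn := one_sub_mul_pow_ne_zero hb hp
  have hbp : ‖b * p‖ < 1 := by simpa using norm_mul_pow_lt_one hb hp 1
  have htp : ‖t * p‖ < 1 := by simpa using norm_mul_pow_lt_one ht hp 1
  have h := (((summable_geomTerm hb ht hp).hasSum.mul_left (1 - t)).sub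
    ((summable_geomTerm hbp htp hp).hasSum.mul_left (b * t * p / (1 - b))))
  rw [h.eq_sub_of_telescope (summable_geomTerm hb ht hp).tendsto_atTop_zero.neg fun n => ?_]
  · simp [geomTerm, qPoch_one]
  · have e2 : qPoch (b * p) p (n + 1) = qPoch b p (n + 1) * (1 - b * p ^ (n + 1)) / (1 - b) := by
      rw [eq_div_iff (by simpa using hbn 0), ← qPoch_succ, qPoch_succ' b p (n + 1), mul_comm]
    have n0 : 1 - b ≠ 0 := by simpa using hbn 0
    have n2 := hbn (n + 1)
    have n4 := qPoch_ne_zero hbn (n + 1)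
    rw [geomTerm, geomTerm, geomTerm, e2, qPoch_succ b p (n + 1)]
    obtain ⟨e, he⟩ : ∃ e, e = 1 - b * p ^ (n + 1) := ⟨_, rfl⟩
    rw [← he] at n2
    rw [← he, mul_pow]
    field_simp
    rw [he]
    ring

/-- Splitting off `n = 0` suffices, because `b^{n+1} t^{n+1} p^{(n+1)²} = btp · (bp)^n (tp)^n
p^{n²}`. -/
theorem tsum_rogersFineTerm_rec {b t p : ℂ} (hb : ‖b‖ < 1) (ht : ‖t‖ < 1) (hp : ‖p‖ < 1) :
    ∑' n, rogersFineTerm b t p n = 1 / ((1 - b) * (1 - t)) +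
      b * t * p / ((1 - b) * (1 - t)) * ∑' n, rogersFineTerm (b * p) (t * p) p n := by
  rw [(summable_rogersFineTerm hb ht hp).tsum_eq_zero_add, ← tsum_mul_left]
  congr 1
  · simp [rogersFineTerm, qPoch_one]
  · refine tsum_congr fun n => ?_
    rw [rogersFineTerm, rogersFineTerm, div_mul_div_comm, qPoch_succ' b, qPoch_succ' t]
    congr 1 <;> ring

/-- Both sides obey the same equation under the simultaneous shift `(b, t) ↦ (bp, tp)`. Their
difference is thus homogeneous and bounded, with a coefficient tending to `0`. -/
theorem tsum_geomTerm {b t p : ℂ} (hb : ‖b‖ < 1) (ht : ‖t‖ < 1) (hp : ‖p‖ < 1) :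
    ∑' n, geomTerm b t p n = ∑' n, rogersFineTerm b t p n := by
  obtain ⟨A, hA⟩ := exists_norm_tsum_le (norm_nonneg t) ht (exists_norm_geomTerm_le hb hp)
  obtain ⟨B, hB⟩ := exists_norm_tsum_le (norm_nonneg t) ht (exists_norm_rogersFineTerm_le hb ht hp)
  have hpow := tendsto_pow_atTop_nhds_zero_of_norm_lt_one hp
  have hbk : Filter.Tendsto (fun k : ℕ => b * p ^ k) Filter.atTop (nhds 0) := by
    simpa using hpow.const_mul b
  have htk : Filter.Tendsto (fun k : ℕ => t * p ^ k) Filter.atTop (nhds 0) := by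
    simpa using hpow.const_mul t
  have hc := ((hbk.mul htk).mul_const p).div ((hbk.const_sub 1).mul (htk.const_sub 1)) (by simp)
  simp only [zero_mul, zero_div] at hc
  have h := eq_zero_of_eq_mul_succ (f := fun k : ℕ =>
    ∑' n, geomTerm (b * p ^ k) (t * p ^ k) p n - ∑' n, rogersFineTerm (b * p ^ k) (t * p ^ k) p n)
    (fun k => (norm_sub_le _ _).trans (add_le_add (hA k) (hB k))) hc fun k => ?_
  · simpa [sub_eq_zero] using h
  · have hbk := norm_mul_pow_lt_one hb hp k
    have htk := norm_mul_pow_lt_one ht hp k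
    have n1 : 1 - b * p ^ k ≠ 0 := one_sub_mul_pow_ne_zero hb hp k
    have n2 : 1 - t * p ^ k ≠ 0 := one_sub_mul_pow_ne_zero ht hp k
    have r1 := tsum_geomTerm_rec hbk htk hp
    rw [tsum_rogersFineTerm_rec hbk htk hp]
    have hk : ∀ a : ℂ, a * p ^ (k + 1) = a * p ^ k * p := fun a => by ring
    simp only [Pi.div_apply, hk]
    generalize b * p ^ k = c at *
    generalize t * p ^ k = s at *
    have r2 : ∑' n, geomTerm c s p n =
        (c * s * p / (1 - c) * ∑' n, geomTerm (c * p) (s * p) p n + 1 / (1 - c)) / (1 - s) := by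
      rw [eq_div_iff n2]
      linear_combination r1
    rw [r2]
    field_simp
    ring

/-! ### Return to the original variables. -/

theorem two_mul_choose_succ_two (n : ℕ) : 2 * (n + 1).choose 2 = n ^ 2 + n := by
  rw [Nat.choose_two_right, Nat.add_sub_cancel, mul_comm (n + 1) n,
    Nat.mul_div_cancel' (Nat.even_mul_succ_self n).two_dvd]
  ring

theorem omegaOneTerm_eq (α z q : ℂ) : omegaOneTerm α z q = mockTerm (z * q) (z * q / α) (q ^ 2) := by
  funext n
  rw [omegaOneTerm, mockTerm, pow_mul]

theorem corrTerm_eq (α z q : ℂ) :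
    corrTerm α z q = fun m =>
      (1 + α / (z * q)) * fineTerm (z * q) (z * q / α) (q ^ 2) m := by
  funext m
  have : -(α / (z * q)) * q ^ 2 = -(q ^ 2 / (z * q / α)) := by
    rw [div_div_eq_mul_div]
    ring
  rw [corrTerm, fineTerm, qPoch_succ' (-(α / (z * q))), this, sub_neg_eq_add]
  ring

theorem partialThetaTerm_eq {α z q : ℂ} (hzq : z * q ≠ 0) :
    partialThetaTerm α q = thetaTerm (z * q) (z * q / α) (q ^ 2) := by
  funext n
  rw [partialThetaTerm, thetaTerm, div_div_cancel₀ hzq, ← pow_mul, two_mul_choose_succ_two]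

theorem smallestPartTerm_succ {α z q : ℂ} (hq : ‖q‖ < 1) (m : ℕ) : smallestPartTerm α z q (m + 1) =
      q ^ 2 / (qPochInf (-(z * q ^ 2 / α)) (q ^ 2) * qPochInf (z * q ^ 2) (q ^ 2)) *
        partsTerm (z * q) (z * q / α) (q ^ 2) m := by
  have hq2 := norm_sq_lt_one hq
  rw [smallestPartTerm, partsTerm, Nat.add_sub_cancel, qPoch_two_mul, qPoch_two_mul,
    qPochInf_eq_mul (-(z * q ^ 2 / α)) hq2 (m + 1), qPochInf_eq_mul (z * q ^ 2) hq2 (m + 1),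
    div_mul_div_comm]
  congr 1
  · rw [show z * q * (z * q / α) = z ^ 2 * q ^ 2 / α by ring]
    ring
  · rw [show -(z * q / α) * q = -(z * q ^ 2 / α) by ring, show z * q * q = z * q ^ 2 by ring,
      show -(z * q ^ 2 / α) * (q ^ 2) ^ (m + 1) = -(z * q ^ (2 * (m + 1) + 2) / α) by ring,
      show z * q ^ 2 * (q ^ 2) ^ (m + 1) = z * q ^ (2 * (m + 1) + 2) by ring]
    ring

theorem hasSum_smallestPartTerm {α z q : ℂ} (hq0 : q ≠ 0) (hq : ‖q‖ < 1) (hz : z ≠ 0)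
    (hzq : ‖z * q‖ < 1) (hα : α ≠ 0) (h1 : ∀ n : ℕ, 1 + z * q ^ (n + 1) / α ≠ 0)
    (h2 : ∀ n : ℕ, 1 - z * q ^ (2 * n + 1) / α ≠ 0) :
    HasSum (fun m : ℕ => smallestPartTerm α z q (m + 1))
      (q ^ 2 * qPochInf (z ^ 2 * q ^ 2 / α) (q ^ 2) /
          (qPochInf (z * q) q * qPochInf (-(z * q / α)) q) * omegaOne α z q + corrF α z q) := by
  have hq2 := norm_sq_lt_one hq
  have hx0 : z * q ≠ 0 := mul_ne_zero hz hq0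
  have hu0 : z * q / α ≠ 0 := div_ne_zero hx0 hα
  have hu : ∀ n : ℕ, 1 - z * q / α * (q ^ 2) ^ n ≠ 0 := fun n => by
    convert h2 n using 1
    ring
  -- Splitting `(-zq/α;q)_∞` into base `q²`, the even indices of `h1` give this factor and the odd
  -- ones the next.
  have hu' : ∀ n : ℕ, 1 - -(z * q / α) * (q ^ 2) ^ n ≠ 0 := fun n => by
    convert h1 (2 * n) using 1
    ring
  have hv : ∀ n : ℕ, 1 - -(z * q ^ 2 / α) * (q ^ 2) ^ n ≠ 0 := fun n => by
    convert h1 (2 * n + 1) using 1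
    ring
  have hw : ∀ n : ℕ, 1 - z * q ^ 2 * (q ^ 2) ^ n ≠ 0 := fun n => by
    convert one_sub_mul_pow_ne_zero hzq hq (2 * n + 1) using 1
    ring
  have a1 := qPochInf_ne_zero hq2 hu
  have a2 := qPochInf_ne_zero hq2 hu'
  have a3 := qPochInf_ne_zero hq2 hv
  have a4 := qPochInf_ne_zero hq2 hw
  have a5 := qPochInf_ne_zero hq2 (one_sub_mul_pow_ne_zero hzq hq2)
  have a6 := qPochInf_ne_zero hq2 (one_sub_neg_mul_pow_ne_zero hzq hq2)
  have n1 : 1 + z * q / α ≠ 0 := by simpa using h1 0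
  have key := tsum_partsTerm hzq hq2 hu0 hu hu'
  have hS := (summable_partsTerm hzq hq2 hu').hasSum.mul_left
    (q ^ 2 / (qPochInf (-(z * q ^ 2 / α)) (q ^ 2) * qPochInf (z * q ^ 2) (q ^ 2)))
  simp only [← smallestPartTerm_succ hq] at hS
  refine Eq.subst (motive := HasSum fun m : ℕ => smallestPartTerm α z q (m + 1)) ?_ hS
  rw [omegaOne, corrF, omegaOneTerm_eq, corrTerm_eq, partialThetaTerm_eq hx0,
    tsum_mul_left, qPochInf_eq_even_mul_odd (z * q) hq, qPochInf_eq_even_mul_odd (-(z * q / α)) hq,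
    show q ^ 4 = (q ^ 2) ^ 2 by ring, show z ^ 2 * q ^ 2 / α ^ 2 = (z * q / α) ^ 2 by ring,
    show z ^ 2 * q ^ 2 = (z * q) ^ 2 by ring, ← qPochInf_mul_qPochInf_neg _ hq2,
    ← qPochInf_mul_qPochInf_neg _ hq2, show -(z * q / α) * q = -(z * q ^ 2 / α) by ring,
    show z * q * q = z * q ^ 2 by ring]
  rw [show z * q * (z * q / α) = (z * q) ^ 2 / α by ring] at key
  have key' := eq_div_of_mul_eq hu0 ((mul_comm _ _).trans key)
  rw [key']
  -- The extra first factor of the series in `F` thus cancels its prefactor `1/(1 + zq/α)`.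
  have e1 : 1 + α / (z * q) = (1 + z * q / α) * (α / (z * q)) := by
    field_simp
    ring
  rw [e1]
  generalize 1 + z * q / α = c at *
  field_simp
  ring

theorem corrF_one {z q : ℂ} (hq0 : q ≠ 0) (hq : ‖q‖ < 1) (hz : z ≠ 0) (hzq : ‖z * q‖ < 1) :
    corrF 1 z q = 0 := by
  have hq2 := norm_sq_lt_one hq
  have hx0 : z * q ≠ 0 := mul_ne_zero hz hq0
  have n0 : 1 + z * q ≠ 0 := by simpa using one_sub_neg_mul_pow_ne_zero hzq hq 0
  have a5 := qPochInf_ne_zero hq2 (one_sub_mul_pow_ne_zero hzq hq2)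
  have a6 := qPochInf_ne_zero hq2 (one_sub_neg_mul_pow_ne_zero hzq hq2)
  rw [corrF, corrTerm_eq, partialThetaTerm_eq hx0, tsum_mul_left]
  simp only [div_one, one_pow, one_mul]
  rw [tsum_fineTerm_self hx0 hzq hq2, show q ^ 4 = (q ^ 2) ^ 2 by ring,
    show z ^ 2 * q ^ 2 = (z * q) ^ 2 by ring, ← qPochInf_mul_qPochInf_neg _ hq2]
  refine mul_eq_zero_of_right _ ?_
  have e1 : 1 + 1 / (z * q) = (1 + z * q) * (1 / (z * q)) := by
    field_simp
    ring
  rw [e1]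
  generalize 1 + z * q = c at *
  field_simp
  ring

/-- The key quotient is `(zq^{n+1};q)_{n+2} = (zq;q)_{2n+2} / (zq;q)_n`; its numerator splits by
parity, and `(x;q)(-x;q) = (x²;q²)` matches the odd powers of `q`. -/
theorem andrewsYeeTerm_succ {z q x : ℂ} (hq : ‖q‖ < 1) (hzq : ‖z * q‖ < 1) (hx : x ^ 2 = z * q)
    (n : ℕ) : andrewsYeeTerm z q (n + 1) =
      q / qPochInf (z * q * q) (q ^ 2) * partsTerm x x q n := by
  have hq2 := norm_sq_lt_one hq
  have hyn := one_sub_mul_pow_ne_zero hzq hq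
  have hyn2 : ∀ k : ℕ, 1 - z * q * q * (q ^ 2) ^ k ≠ 0 := fun k => by
    convert hyn (2 * k + 1) using 1
    ring
  have c0 := qPoch_ne_zero hyn n
  have c1 := qPoch_ne_zero hyn2 (n + 1)
  have e1 : qPoch (z * q ^ (n + 1)) q (n + 1 + 1) =
      qPoch (z * q) (q ^ 2) (n + 1) * qPoch (z * q * q) (q ^ 2) (n + 1) / qPoch (z * q) q n := by
    rw [eq_div_iff c0, ← qPoch_two_mul, show 2 * (n + 1) = n + (n + 1 + 1) by ring,
      qPoch_add (z * q) q n, mul_comm,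
      show z * q ^ (n + 1) = z * q * q ^ n by ring]
  rw [andrewsYeeTerm, partsTerm, e1, qPochInf_eq_mul (z * q * q) hq2 (n + 1), ← pow_two x, hx,
    mul_comm (qPoch (-x) q (n + 1)), qPoch_mul_qPoch_neg, hx,
    show z * q * q * (q ^ 2) ^ (n + 1) = z * q ^ (2 * (n + 1) + 2) by ring, pow_succ q n]
  field_simp

theorem omegaTwoVarTerm_eq (z q : ℂ) : omegaTwoVarTerm z q = rogersFineTerm (z * q) q (q ^ 2) := by
  funext n
  rw [omegaTwoVarTerm, rogersFineTerm]
  congr 1 <;> ring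

theorem hasSum_andrewsYeeTerm {z q : ℂ} (hq0 : q ≠ 0) (hq : ‖q‖ < 1) (hz : z ≠ 0)
    (hzq : ‖z * q‖ < 1) :
    HasSum (fun m : ℕ => andrewsYeeTerm z q (m + 1)) (q * omegaTwoVar z q) := by
  -- Either square root of `zq` serves.
  obtain ⟨x, hx⟩ := IsAlgClosed.exists_pow_nat_eq (z * q) two_pos
  have hx0 : x ≠ 0 := by
    rintro rfl
    exact mul_ne_zero hz hq0 (by simpa using hx.symm)
  have hx1 : ‖x‖ < 1 := by
    rw [← hx, norm_pow] at hzq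
    exact (pow_lt_one_iff_of_nonneg (norm_nonneg x) two_ne_zero).1 hzq
  have hq2 := norm_sq_lt_one hq
  have hS := (summable_partsTerm hx1 hq (one_sub_neg_mul_pow_ne_zero hx1 hq)).hasSum.mul_left
    (q / qPochInf (z * q * q) (q ^ 2))
  simp only [← andrewsYeeTerm_succ hq hzq hx] at hS
  have hmock : mockTerm x x q = geomTerm (z * q) q (q ^ 2) := by
    funext n
    rw [mockTerm, geomTerm, mul_comm (qPoch (-x) q _), qPoch_mul_qPoch_neg, hx]
  have a1 := qPochInf_ne_zero hq2 (one_sub_mul_pow_ne_zero hzq hq2)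
  have a2 : qPochInf (z * q * q) (q ^ 2) ≠ 0 := qPochInf_ne_zero hq2 fun k => by
    convert one_sub_mul_pow_ne_zero hzq hq (2 * k + 1) using 1
    ring
  refine Eq.subst (motive := HasSum fun m : ℕ => andrewsYeeTerm z q (m + 1)) ?_ hS
  rw [tsum_partsTerm_self hx0 hx1 hq, hx, qPochInf_eq_even_mul_odd (z * q) hq, hmock,
    tsum_geomTerm hzq hq hq2, omegaTwoVar, omegaTwoVarTerm_eq,
    mul_div_cancel_left₀ _ a1, ← mul_assoc, div_mul_cancel₀ _ a2]

/-- The sums over `m ≥ 1` are indexed by `m + 1` with `m : ℕ`. The hypotheses on `α` say that no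
denominator in the identity vanishes; for `|zq| < 1` the other denominators are never zero. -/
theorem theorem1p2 (q z : ℂ) (hq0 : q ≠ 0) (hq : ‖q‖ < 1) (hz : z ≠ 0) (hzq : ‖z * q‖ < 1) :
    (∀ α : ℂ, α ≠ 0 →
      (∀ n : ℕ, 1 + z * q ^ (n + 1) / α ≠ 0) →
      (∀ n : ℕ, 1 - z * q ^ (2 * n + 1) / α ≠ 0) →
        Summable (omegaOneTerm α z q) ∧
        Summable (corrTerm α z q) ∧
        Summable (partialThetaTerm α q) ∧
        HasSum (fun m : ℕ => smallestPartTerm α z q (m + 1))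
          (q ^ 2 * qPochInf (z ^ 2 * q ^ 2 / α) (q ^ 2) /
              (qPochInf (z * q) q * qPochInf (-(z * q / α)) q) * omegaOne α z q +
            corrF α z q)) ∧
    corrF 1 z q = 0 ∧
    Summable (omegaTwoVarTerm z q) ∧
    HasSum (fun m : ℕ => andrewsYeeTerm z q (m + 1)) (q * omegaTwoVar z q) := by
  refine ⟨fun α hα h1 h2 => ?_, corrF_one hq0 hq hz hzq, ?_, hasSum_andrewsYeeTerm hq0 hq hz hzq⟩
  · have hx0 : z * q ≠ 0 := mul_ne_zero hz hq0
    have hq2 := norm_sq_lt_one hq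
    refine ⟨?_, ?_, ?_, hasSum_smallestPartTerm hq0 hq hz hzq hα h1 h2⟩
    · rw [omegaOneTerm_eq]
      refine summable_mockTerm hzq hq2 fun n => ?_
      convert h2 n using 1
      ring
    · rw [corrTerm_eq]
      exact (summable_fineTerm _ hzq hq2).mul_left _
    · rw [partialThetaTerm_eq hx0]
      exact summable_thetaTerm _ _ hq2
  · rw [omegaTwoVarTerm_eq]
    exact summable_rogersFineTerm hzq hq (norm_sq_lt_one hq)
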